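/- **Setting.** There are $L\ge 2$ items. At each time step $t=1,\dots,T$ ($T\ge1$) a reward vector $W_t=(W_t(1),\dots,W_t(L))\in[0,1]^L$ is drawn, i.i.d. over time from a law $\nu$; the mean of its $i$-th coordinate is $w(i)$, and $w(1)>w(2)\ge\dots\ge w(L)$. Put $\Delta_{1,i}=w(1)-w(i)$. An adaptive (possibly randomized) adversary sees the current reward vector $W_t$ and the whole past (rewards, corruptions, pulled items), but not the item $i_t$ about to be pulled, and chooses corruptions $c_t(i)\in[-1,1]$ with $\tilde W_t(i)=W_t(i)+c_t(i)\in[0,1]$, subject to the budget $\sum_{t=1}^T\max_i|c_t(i)|\le C$. The agent then pulls $i_t$ and observes $\tilde W_t(i_t)$. **Algorithm PSS$(u)$**, $u\in(1,L]$. Let $M=\lceil\log_u L\rceil$, $N=\lfloor T/M\rfloor$, $A_0=\{1,\dots,L\}$. In phase $m=1,\dots,M$, at each of the steps $t=(m-1)N+1,\dots,mN$, the item $i_t$ is drawn uniformly from $A_{m-1}$, independently of everything else given the past; at the end of the phase, $\hat w_m(i)=\frac{|A_{m-1}|}{N}\sum_{t=(m-1)N+1}^{mN}\tilde W_t(i_t)\mathbb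 I\{i_t=i\}$ is computed for $i\in A_{m-1}$, and $A_m$ consists of the $\lceil L/u^m\rceil$ items of $A_{m-1}$ with the highest $\hat w_m(i)$ (ties broken in any way). The output $i_{\mathrm{out}}$ is the single item of $A_M$. **Theorem.** Let $\tilde H_2(w,L,u)=\max_{i\ne1}\min\{ui,L\}/\Delta_{1,i}^2$. 1. For every $u\in(1,L]$, every such instance, every $T\ge 1$, every $C$ and every such adversary, $$\mathbb P\Big[\Delta_{1,i_{\mathrm{out}}}>\frac{8C\lceil\log_u L\rceil}{T}\Big]\le\delta_T:=4\lceil\log_u L\rceil(L-1)\exp\Big[-\frac{1}{192\tilde H_2(w,L,u)}\Big\lfloor\frac{T}{\lceil\log_u L\rceil}\Big\rfloor\Big].$$ 2. With a universal implied constant, $\delta_T=O\Big(L(\log_u L)\exp\Big[-\dfrac{T}{192\,\tilde H_2(w,L,u)\lceil\log_u L\rceil}\Big]\Big)$. 3. Consequently PSS$(u)$ is $(O(C\log_u L/T),e^{-\Theta(T)})$-PAC: there is a universal constant $K>0$ such that for all $L$, $u\in(1,L]$ and $w$ there are $a,b>0$ and $T_0\ge1$ depending only on $L,u,w$ with $e^{-bT}\le\delta_T\le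 e^{-aT}$ for all $T\ge T_0$, and, for all $T\ge T_0$, every reward law with means $w$, every $C$ and every adversary with budget $C$, $\mathbb P[\Delta_{1,i_{\mathrm{out}}}>KC\log_u L/T]\le\delta_T$. -/

import Mathlib

open MeasureTheory ProbabilityTheory

universe v

noncomputable section

namespace CorruptedBandit

/-- A stochastic bandit instance with `L` items, indexed by `Fin L`, so that item number
`k` (with `1 ≤ k ≤ L`) is the index `i` with `i.val + 1 = k`, and the optimal item is `0`.
`ν` is the joint law of the vector of rewards of one time step (its `i`-th marginal is the reward
distribution of item `i`; no independence between different items is imposed), it is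
supported in `[0,1]^L`, and `w` is the vector of mean rewards, with
`w 0 > w 1 ≥ w 2 ≥ … ≥ w (L-1)`. -/
structure IsInstance {L : ℕ} [NeZero L] (w : Fin L → ℝ) (ν : Measure (Fin L → ℝ)) : Prop where
  isProbabilityMeasure : IsProbabilityMeasure ν
  support : ∀ᵐ x ∂ν, ∀ i, x i ∈ Set.Icc (0 : ℝ) 1
  mean : ∀ i, ∫ x, x i ∂ν = w i
  antitone : Antitone w
  best : ∀ i, i ≠ 0 → w i < w 0

/-- The optimality gap of item `i`. -/
def gap {L : ℕ} [NeZero L] (w : Fin L → ℝ) (i : Fin L) : ℝ := w 0 - w i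

/-- The hardness `max_{i ≠ 1} min{u i, L} / Δ_{1,i}^2` (with items numbered from `1`). -/
def hardness {L : ℕ} [NeZero L] (w : Fin L → ℝ) (u : ℝ) : ℝ :=
  ⨆ i : {i : Fin L // i ≠ 0}, min (u * ((i.1.val : ℝ) + 1)) (L : ℝ) / gap w i.1 ^ 2

/-- The number `M` of phases. -/
def numPhases (L : ℕ) (u : ℝ) : ℕ := ⌈Real.logb u L⌉₊

/-- The length `N` of a phase. -/
def phaseLength (L : ℕ) (u : ℝ) (T : ℕ) : ℕ := T / numPhases L u

/-- The interaction of the environment with an adaptive adversary over the steps `t = 1, …, T`.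
`W t` is the vector of true rewards of step `t`, `c t` the vector of corruptions chosen by the
adversary, `I t` the item pulled by the agent. `ℱ t` is the information generated during the
steps `1, …, t`: it contains `W s`, `c s`, `I s` for `s ≤ t`, and possibly private randomness of
the adversary (or of the agent). The rewards of each step are fresh draws from `ν`,
and the total amount of corruption is at most `C`. The corruption `c t` may depend on
everything in `ℱ (t - 1)` and on `W t`; that the adversary does not see `I t` when it chooses
`c t` is part of the sampling rule of the agent. -/
structure IsCorruptedRun {L : ℕ} {Ω : Type*} [mΩ : MeasurableSpace Ω] (μ : Measure Ω)
    (ℱ : Filtration ℕ mΩ) (ν : Measure (Fin L → ℝ)) (T : ℕ) (C : ℝ)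
    (W c : ℕ → Ω → Fin L → ℝ) (I : ℕ → Ω → Fin L) : Prop where
  measurable_reward : ∀ t, 1 ≤ t → t ≤ T → Measurable[ℱ t] (W t)
  measurable_corruption : ∀ t, 1 ≤ t → t ≤ T → Measurable[ℱ t] (c t)
  measurable_pull : ∀ t, 1 ≤ t → t ≤ T → Measurable[ℱ t] (I t)
  reward_law : ∀ t, 1 ≤ t → t ≤ T → μ.map (W t) = ν
  reward_fresh : ∀ t, t < T →
    Indep (MeasurableSpace.comap (W (t + 1)) inferInstance) (ℱ t) μ
  corruption_range : ∀ᵐ ω ∂μ, ∀ t, 1 ≤ t → t ≤ T → ∀ i,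
    c t ω i ∈ Set.Icc (-1 : ℝ) 1 ∧ W t ω i + c t ω i ∈ Set.Icc (0 : ℝ) 1
  budget : ∀ᵐ ω ∂μ, ∑ t ∈ Finset.Icc 1 T, ⨆ i, |c t ω i| ≤ C

/-- The corrupted empirical mean of item `i` in the phase that consists of the steps
`m N + 1, …, (m + 1) N` (phase number `m + 1`), when `B` is the active set during that phase:
the sum of the observed corrupted rewards of `i`, divided by the expected number `N / |B|`
of pulls. -/
def empMean {L : ℕ} {Ω : Type*} (N : ℕ) (W c : ℕ → Ω → Fin L → ℝ) (I : ℕ → Ω → Fin L)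
    (m : ℕ) (B : Finset (Fin L)) (ω : Ω) (i : Fin L) : ℝ :=
  (∑ t ∈ Finset.Ioc (m * N) ((m + 1) * N),
      if I t ω = i then W t ω (I t ω) + c t ω (I t ω) else 0) / ((N : ℝ) / (B.card : ℝ))

/-- The agent plays Probabilistic Sequential Shrinking with parameter `u` and horizon `T`.
`A m` is the active set at the end of phase `m` (`A 0` consists of all items), and `out` is the
item that is output. -/
structure IsPSS {L : ℕ} {Ω : Type*} [mΩ : MeasurableSpace Ω] (μ : Measure Ω)
    (ℱ : Filtration ℕ mΩ) (u : ℝ) (T : ℕ) (W c : ℕ → Ω → Fin L → ℝ) (I : ℕ → Ω → Fin L)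
    (A : ℕ → Ω → Finset (Fin L)) (out : Ω → Fin L) : Prop where
  /-- Initially all items are active. -/
  active_zero : ∀ ω, A 0 ω = Finset.univ
  /-- The active set is known at the end of the phase. -/
  measurable_active : ∀ m, m ≤ numPhases L u → ∀ i,
    MeasurableSet[ℱ (m * phaseLength L u T)] {ω | i ∈ A m ω}
  /-- At each step of phase `m + 1`, given the whole past and the true rewards and
  corruptions of that step, the pulled item is uniformly distributed on the active set. -/
  sampling : ∀ m, m < numPhases L u →
    ∀ t, m * phaseLength L u T ≤ t → t < (m + 1) * phaseLength L u T → ∀ i,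
    μ[Set.indicator {ω | I (t + 1) ω = i} (fun _ => (1 : ℝ)) |
        ℱ t ⊔ MeasurableSpace.comap (W (t + 1)) inferInstance
          ⊔ MeasurableSpace.comap (c (t + 1)) inferInstance]
      =ᵐ[μ] fun ω => if i ∈ A m ω then 1 / ((A m ω).card : ℝ) else 0
  /-- Phase `m + 1` keeps only active items, … -/
  active_subset : ∀ m, m < numPhases L u → ∀ ω, A (m + 1) ω ⊆ A m ω
  /-- … exactly `⌈L / u ^ (m + 1)⌉` of them, … -/
  active_card : ∀ m, m < numPhases L u → ∀ ω, (A (m + 1) ω).card = ⌈(L : ℝ) / u ^ (m + 1)⌉₊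
  /-- … namely those with the highest empirical means (ties are broken in any way). -/
  active_top : ∀ m, m < numPhases L u → ∀ ω, ∀ i ∈ A (m + 1) ω, ∀ j ∈ A m ω, j ∉ A (m + 1) ω →
    empMean (phaseLength L u T) W c I m (A m ω) ω j
      ≤ empMean (phaseLength L u T) W c I m (A m ω) ω i
  /-- The output is the single item that is active after the last phase. -/
  output : ∀ ω, out ω ∈ A (numPhases L u) ω

/-- The output `out` is `(ε, δ)`-PAC: it fails to be `ε`-optimal with probability at most `δ`. -/
def IsPAC {L : ℕ} [NeZero L] {Ω : Type*} [MeasurableSpace Ω] (μ : Measure Ω)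
    (w : Fin L → ℝ) (out : Ω → Fin L) (ε δ : ℝ) : Prop :=
  μ.real {ω | ε < gap w (out ω)} ≤ δ

/-- The bound `4 M (L - 1) exp (-⌊T / M⌋ / (192 H))` on the failure probability, where
`M = ⌈log_u L⌉` and `H` is the hardness. -/
def failureBound {L : ℕ} [NeZero L] (w : Fin L → ℝ) (u : ℝ) (T : ℕ) : ℝ :=
  4 * ⌈Real.logb u L⌉₊ * ((L : ℝ) - 1) *
    Real.exp (-(1 / (192 * hardness w u) * (⌊(T : ℝ) / ⌈Real.logb u L⌉₊⌋₊ : ℝ)))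

end CorruptedBandit

end

namespace CorruptedBandit

/-! Fix a phase with `n` active items and compare the best item `0` with another active item `j` of
gap `Δ`. The pull is uniform given the past, the rewards and the corruptions of the step, so the
corruption shifts the conditional mean of the observed difference by exactly `(c j - c 0) / n`,
however adaptively it was chosen. Subtracting this shift leaves only the rewards, which are
independent of the past and have drift `-Δ / n`. With the quadratic correction `3 s ^ 2 / n`, the
exponential of `s` times the accumulated difference is therefore a supermartingale
(`integral_mul_exp_increment_le`, iterated in `expProcess_bound`).

If `j` beats `0`, the observed difference is nonnegative, and the subtracted corruption is at most
`2 C` in total, which is at most half of the accumulated drift once `Δ > 4 C / N`. Markov's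
inequality then bounds the probability by `exp (-N Δ ^ 2 / (48 n))` (`measureReal_empMean_le`).

A bad output forces such an event: when `0` is eliminated, the survivor with the largest index has
gap at least that of the output, and its index is at least the number of survivors
(`IsPSS.exists_beaten`). This index bound gives `n / Δ ^ 2 ≤ H` with `H` the hardness, and a union
bound over phases and items finishes. The asymptotic claims only require control of the roundings.
-/

/-! ### One-step exponential moment estimates. -/

theorem exp_le_one_add_add_sq {x : ℝ} (hx : |x| ≤ 1) : Real.exp x ≤ 1 + x + x ^ 2 := by
  have := (abs_le.1 (Real.abs_exp_sub_one_sub_id_le hx)).2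
  linarith

/-- Integrating a product against an indicator only sees the conditional probability. -/
theorem integral_mul_eq_integral_mul_condExp {Ω : Type*} {m mΩ : MeasurableSpace Ω}
    {μ : Measure Ω} [IsFiniteMeasure μ] (hm : m ≤ mΩ) {f g : Ω → ℝ}
    (hf : StronglyMeasurable[m] f) (hfg : Integrable (f * g) μ) (hg : Integrable g μ) :
    ∫ ω, f ω * g ω ∂μ = ∫ ω, f ω * (μ[g | m]) ω ∂μ := by
  have h1 : ∫ ω, (μ[f * g | m]) ω ∂μ = ∫ ω, (f * g) ω ∂μ := integral_condExp hm
  have h2 := condExp_mul_of_stronglyMeasurable_left hf hfg hg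
  rw [integral_congr_ae h2] at h1
  exact h1.symm

theorem integrable_of_ae_abs_le {Ω : Type*} {mΩ : MeasurableSpace Ω}
    {μ : Measure Ω} [IsFiniteMeasure μ] {f : Ω → ℝ} (hf : Measurable f) {B : ℝ}
    (hB : ∀ᵐ ω ∂μ, |f ω| ≤ B) : Integrable f μ :=
  Integrable.of_bound hf.aestronglyMeasurable B hB

/-- Moment generating function of the difference of two rewards. -/
theorem integral_exp_sub_le {L : ℕ} [NeZero L] {w : Fin L → ℝ} {ν : Measure (Fin L → ℝ)}
    (hν : IsInstance w ν) (j : Fin L) {s : ℝ} (hs : |s| ≤ 1) :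
    ∫ x, Real.exp (s * (x j - x 0)) ∂ν ≤ Real.exp (-(s * gap w j) + s ^ 2) := by
  have := hν.isProbabilityMeasure
  have hint : ∀ i, Integrable (fun x : Fin L → ℝ => x i) ν := fun i =>
    integrable_of_ae_abs_le (measurable_pi_apply i) (B := 1) (by
      filter_upwards [hν.support] with x hx
      exact abs_le.2 ⟨by linarith [(hx i).1], (hx i).2⟩)
  have hb : ∀ᵐ x ∂ν, |s * (x j - x 0)| ≤ 1 := by
    filter_upwards [hν.support] with x hx
    rw [abs_mul]
    have : |x j - x 0| ≤ 1 := abs_le.2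
      ⟨by linarith [(hx j).1, (hx 0).2], by linarith [(hx j).2, (hx 0).1]⟩
    exact mul_le_one₀ hs (abs_nonneg _) this
  have h2 : ∀ᵐ x ∂ν, Real.exp (s * (x j - x 0)) ≤ (1 + s ^ 2) + s * (x j - x 0) := by
    filter_upwards [hb, hν.support] with x hx hx'
    have h3 := exp_le_one_add_add_sq hx
    have h4 : (x j - x 0) ^ 2 ≤ 1 := by
      rw [sq_le_one_iff_abs_le_one, abs_le]
      exact ⟨by linarith [(hx' j).1, (hx' 0).2], by linarith [(hx' j).2, (hx' 0).1]⟩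
    have h5 : (s * (x j - x 0)) ^ 2 ≤ s ^ 2 := by
      rw [mul_pow]; exact mul_le_of_le_one_right (sq_nonneg s) h4
    linarith
  have hi2 : Integrable (fun x : Fin L → ℝ => s * (x j - x 0)) ν :=
    ((hint j).sub (hint 0)).const_mul s
  have hi3 : Integrable (fun x : Fin L → ℝ => Real.exp (s * (x j - x 0))) ν :=
    integrable_of_ae_abs_le (by fun_prop) (B := Real.exp 1) (by
      filter_upwards [hb] with x hx
      rw [Real.abs_exp]
      exact Real.exp_le_exp.2 (le_of_abs_le hx))
  calc _ ≤ ∫ x, ((1 + s ^ 2) + s * (x j - x 0)) ∂ν :=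
        integral_mono_ae hi3 ((integrable_const _).add hi2) h2
    _ = 1 + s ^ 2 + s * (w j - w 0) := by
        rw [integral_add (integrable_const _) hi2, integral_const_mul,
          integral_sub (hint j) (hint 0), hν.mean, hν.mean]
        simp
    _ ≤ _ := by
        have := Real.add_one_le_exp (-(s * gap w j) + s ^ 2)
        unfold gap at *
        linarith

/-- The increment, in one step, of the exponent of the supermartingale that compares items
`j` and `0` when `n` items are active. -/
noncomputable def increment {L : ℕ} [NeZero L] (w : Fin L → ℝ) (n s : ℝ) (j : Fin L)
    (x c : Fin L → ℝ) (k : Fin L) : ℝ :=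
  s * ((if k = j then x k + c k else 0) - (if k = 0 then x k + c k else 0))
    - s * (c j - c 0) / n + (s * gap w j - 3 * s ^ 2) / n

/-- The events of pulling `j` and of pulling `0` are disjoint, so the exponential is affine in their
indicators, and conditioning may replace each indicator by `1 / n`. -/
theorem exp_increment {L : ℕ} [NeZero L] (w : Fin L → ℝ) (n s : ℝ) {j : Fin L} (hj : j ≠ 0)
    (x c : Fin L → ℝ) (k : Fin L) :
    Real.exp (increment w n s j x c k) =
      Real.exp (-(s * (c j - c 0) / n) + (s * gap w j - 3 * s ^ 2) / n) *
        (1 + (Real.exp (s * (x j + c j)) - 1) * (if k = j then 1 else 0)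
          + (Real.exp (-(s * (x 0 + c 0))) - 1) * (if k = 0 then 1 else 0)) := by
  unfold increment
  rw [show ∀ a b d : ℝ, a - b + d = (-b + d) + a by intros; ring, Real.exp_add]
  congr 1
  by_cases h1 : k = j
  · subst h1; simp [hj]
  · by_cases h2 : k = 0
    · subst h2
      simp only [h1, if_true, if_false]
      rw [zero_sub, mul_neg]
      ring
    · simp [h1, h2]

/-- A crude bound: it only serves to keep the exponential process bounded, hence integrable, over
finitely many steps. -/
theorem abs_increment_le {L : ℕ} [NeZero L] (w : Fin L → ℝ) {n s : ℝ} (hn : 1 ≤ n)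
    (hs : |s| ≤ 1) (j : Fin L) {x c : Fin L → ℝ} (k : Fin L)
    (hc : ∀ i, c i ∈ Set.Icc (-1 : ℝ) 1 ∧ x i + c i ∈ Set.Icc (0 : ℝ) 1) :
    |increment w n s j x c k| ≤ 6 + |gap w j| := by
  have hn0 : 0 < n := by linarith
  have hdiv : ∀ a : ℝ, |a / n| ≤ |a| := fun a => by
    rw [abs_div, abs_of_pos hn0]; exact div_le_self (abs_nonneg _) hn
  have hmul : ∀ a : ℝ, |s * a| ≤ |a| := fun a => by
    rw [abs_mul]; exact mul_le_of_le_one_left (abs_nonneg _) hs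
  have hif : ∀ i, (if k = i then x k + c k else 0) ∈ Set.Icc (0 : ℝ) 1 := fun i => by
    split_ifs
    · exact (hc k).2
    · simp
  have h1 : |s * ((if k = j then x k + c k else 0) - (if k = 0 then x k + c k else 0))| ≤ 1 := by
    refine (hmul _).trans (abs_le.2 ⟨?_, ?_⟩)
    · linarith [(hif j).1, (hif 0).2]
    · linarith [(hif j).2, (hif 0).1]
  have h2 : |s * (c j - c 0) / n| ≤ 2 := by
    refine (hdiv _).trans ((hmul _).trans (abs_le.2 ⟨?_, ?_⟩))
    · linarith [(hc j).1.1, (hc 0).1.2]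
    · linarith [(hc j).1.2, (hc 0).1.1]
  have h3 : |(s * gap w j - 3 * s ^ 2) / n| ≤ |gap w j| + 3 := by
    refine (hdiv _).trans ((abs_sub _ _).trans ?_)
    have h4 : |3 * s ^ 2| ≤ 3 := by
      rw [abs_of_nonneg (by positivity)]
      have := (sq_le_one_iff_abs_le_one s).2 hs
      linarith
    linarith [hmul (gap w j)]
  unfold increment
  refine (abs_add_le _ _).trans ?_
  refine (add_le_add (abs_sub _ _) le_rfl).trans ?_
  linarith

theorem measurable_increment {L : ℕ} [NeZero L] (w : Fin L → ℝ) (n s : ℝ) (j : Fin L)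
    {Ω : Type*} {m : MeasurableSpace Ω} {W c : Ω → Fin L → ℝ} {I : Ω → Fin L}
    (hW : Measurable W) (hc : Measurable c) (hI : Measurable I) :
    Measurable fun ω => increment w n s j (W ω) (c ω) (I ω) := by
  have h : Measurable fun p : ((Fin L → ℝ) × (Fin L → ℝ)) × Fin L =>
      increment w n s j p.1.1 p.1.2 p.2 := by
    refine measurable_from_prod_countable_left fun k => ?_
    unfold increment
    dsimp only
    split_ifs <;> fun_prop
  exact h.comp ((hW.prodMk hc).prodMk hI)

/-- After conditioning on rewards and corruptions, only the noise of the rewards remains. -/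
theorem exp_conditional_le {n s Δ p q x y a b : ℝ} (hn : 1 ≤ n) (hs : |s| ≤ 1)
    (hp : p ∈ Set.Icc (0 : ℝ) 1) (hq : q ∈ Set.Icc (0 : ℝ) 1) (hpx : p = x + a) (hqy : q = y + b) :
    Real.exp (-(s * (a - b) / n) + (s * Δ - 3 * s ^ 2) / n) *
        (1 + (Real.exp (s * p) - 1) * (1 / n) + (Real.exp (-(s * q)) - 1) * (1 / n)) ≤
      Real.exp (s / n * (x - y)) * Real.exp ((s * Δ - s ^ 2) / n) := by
  have hn0 : 0 < n := by linarith
  have key : ∀ r ∈ Set.Icc (0 : ℝ) 1, |s * r| ≤ 1 ∧ (s * r) ^ 2 ≤ s ^ 2 := fun r hr => by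
    have hr' : |r| ≤ 1 := abs_le.2 ⟨by linarith [hr.1], hr.2⟩
    refine ⟨by rw [abs_mul]; exact mul_le_one₀ hs (abs_nonneg _) hr', ?_⟩
    rw [mul_pow]
    exact mul_le_of_le_one_right (sq_nonneg s) ((sq_le_one_iff_abs_le_one r).2 hr')
  have h1 := exp_le_one_add_add_sq (key p hp).1
  have h2 := exp_le_one_add_add_sq (x := -(s * q)) (by rw [abs_neg]; exact (key q hq).1)
  have h3 := (key p hp).2
  have h4 := (key q hq).2
  -- The randomness of the pull costs `2 s ^ 2 / n`, one `s ^ 2 / n` for each of the two items; the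
  -- remaining third of the correction is kept for the noise of the rewards.
  have h5 : 1 + (Real.exp (s * p) - 1) * (1 / n) + (Real.exp (-(s * q)) - 1) * (1 / n) ≤
      Real.exp ((s * (p - q) + 2 * s ^ 2) / n) := by
    have h6 := Real.add_one_le_exp ((s * (p - q) + 2 * s ^ 2) / n)
    refine le_trans ?_ h6
    have : ((Real.exp (s * p) - 1) + (Real.exp (-(s * q)) - 1)) / n ≤
        (s * (p - q) + 2 * s ^ 2) / n := by
      refine div_le_div_of_nonneg_right ?_ hn0.le
      rw [neg_sq] at h2
      linarith
    calc _ = ((Real.exp (s * p) - 1) + (Real.exp (-(s * q)) - 1)) / n + 1 := by ring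
      _ ≤ _ := by linarith
  refine (mul_le_mul_of_nonneg_left h5 (Real.exp_nonneg _)).trans (le_of_eq ?_)
  rw [← Real.exp_add, ← Real.exp_add]
  congr 1
  subst hpx hqy
  field_simp
  ring

/-- One step of the supermartingale. -/
theorem integral_mul_exp_increment_le {L : ℕ} [NeZero L] {w : Fin L → ℝ}
    {ν : Measure (Fin L → ℝ)} (hν : IsInstance w ν) {Ω : Type*} {ℱ 𝒢 mΩ : MeasurableSpace Ω}
    {μ : Measure Ω} [IsProbabilityMeasure μ] (hℱ : ℱ ≤ mΩ) {W c : Ω → Fin L → ℝ} {I : Ω → Fin L}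
    (hW : Measurable W) (hc : Measurable c) (hI : Measurable I) (hlaw : μ.map W = ν)
    (hindep : Indep (MeasurableSpace.comap W inferInstance) ℱ μ)
    (hrange : ∀ᵐ ω ∂μ, ∀ i, c ω i ∈ Set.Icc (-1 : ℝ) 1 ∧ W ω i + c ω i ∈ Set.Icc (0 : ℝ) 1)
    {V : Ω → ℝ} (hV : Measurable[ℱ] V) (hV0 : ∀ ω, 0 ≤ V ω) {B : ℝ}
    (hVB : ∀ᵐ ω ∂μ, V ω ≤ B) {n s : ℝ} (hn : 1 ≤ n) (hs : |s| ≤ 1) {j : Fin L} (hj : j ≠ 0)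
    (h𝒢 : 𝒢 = ℱ ⊔ MeasurableSpace.comap W inferInstance ⊔ MeasurableSpace.comap c inferInstance)
    (hsamp : ∀ i, i = j ∨ i = 0 → ∀ᵐ ω ∂μ, V ω ≠ 0 →
      (μ[Set.indicator {ω | I ω = i} (fun _ => (1 : ℝ)) | 𝒢]) ω = 1 / n) :
    Integrable (fun ω => V ω * Real.exp (increment w n s j (W ω) (c ω) (I ω))) μ ∧
    ∫ ω, V ω * Real.exp (increment w n s j (W ω) (c ω) (I ω)) ∂μ ≤ ∫ ω, V ω ∂μ := by
  have hn0 : 0 < n := by linarith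
  have h𝒢le : 𝒢 ≤ mΩ := h𝒢 ▸ sup_le (sup_le hℱ hW.comap_le) hc.comap_le
  have hVm : Measurable V := hV.mono hℱ le_rfl
  have hV𝒢 : Measurable[𝒢] V := hV.mono (h𝒢 ▸ le_sup_left.trans le_sup_left) le_rfl
  have hW𝒢 : Measurable[𝒢] W :=
    (comap_measurable W).mono (h𝒢 ▸ le_sup_right.trans le_sup_left) le_rfl
  have hc𝒢 : Measurable[𝒢] c := (comap_measurable c).mono (h𝒢 ▸ le_sup_right) le_rfl
  have hVabs : ∀ᵐ ω ∂μ, |V ω| ≤ B := by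
    filter_upwards [hVB] with ω hω
    rwa [abs_of_nonneg (hV0 ω)]
  have hVint : Integrable V μ := integrable_of_ae_abs_le hVm hVabs
  let D : Ω → ℝ := fun ω =>
    V ω * Real.exp (-(s * (c ω j - c ω 0) / n) + (s * gap w j - 3 * s ^ 2) / n)
  let f₁ : Ω → ℝ := fun ω => D ω * (Real.exp (s * (W ω j + c ω j)) - 1)
  let f₂ : Ω → ℝ := fun ω => D ω * (Real.exp (-(s * (W ω 0 + c ω 0))) - 1)
  let ind : Fin L → Ω → ℝ := fun i => Set.indicator {ω | I ω = i} (fun _ => (1 : ℝ))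
  have hD𝒢 : Measurable[𝒢] D := by
    have h1 := (measurable_pi_apply j).comp hc𝒢
    have h2 := (measurable_pi_apply (0 : Fin L)).comp hc𝒢
    exact hV𝒢.mul (((((h1.sub h2).const_mul s).div_const n).neg.add_const _).exp)
  have hf₁𝒢 : Measurable[𝒢] f₁ := by
    have h1 := (measurable_pi_apply j).comp hc𝒢
    have h2 := (measurable_pi_apply j).comp hW𝒢
    exact hD𝒢.mul ((((h2.add h1).const_mul s).exp).sub_const 1)
  have hf₂𝒢 : Measurable[𝒢] f₂ := by
    have h1 := (measurable_pi_apply (0 : Fin L)).comp hc𝒢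
    have h2 := (measurable_pi_apply (0 : Fin L)).comp hW𝒢
    exact hD𝒢.mul ((((h2.add h1).const_mul s).neg.exp).sub_const 1)
  have hind : ∀ i, Measurable (ind i) := fun i =>
    measurable_const.indicator (hI (measurableSet_singleton i))
  have hind1 : ∀ i ω, |ind i ω| ≤ 1 := fun i ω => by
    simp only [ind, Set.indicator_apply]; split_ifs <;> simp
  have hD : ∀ᵐ ω ∂μ, |D ω| ≤ B * Real.exp (|s| * 2 / n + (s * gap w j - 3 * s ^ 2) / n) := by
    filter_upwards [hVabs, hrange] with ω h1 h2
    simp only [D]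
    rw [abs_mul, Real.abs_exp]
    refine mul_le_mul h1 ?_ (Real.exp_nonneg _) ((abs_nonneg _).trans h1)
    refine Real.exp_le_exp.2 (add_le_add ?_ le_rfl)
    rw [← neg_div]
    refine div_le_div_of_nonneg_right ?_ hn0.le
    refine (neg_le_abs _).trans ?_
    rw [abs_mul]
    refine mul_le_mul_of_nonneg_left (abs_le.2 ⟨?_, ?_⟩) (abs_nonneg s)
    · linarith [(h2 j).1.1, (h2 0).1.2]
    · linarith [(h2 j).1.2, (h2 0).1.1]
  set B' := B * Real.exp (|s| * 2 / n + (s * gap w j - 3 * s ^ 2) / n) with hB'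
  have hexp : ∀ t : ℝ, |t| ≤ |s| → |Real.exp t - 1| ≤ 2 := fun t ht => by
    have := Real.abs_exp_sub_one_le (ht.trans hs)
    linarith [ht.trans hs]
  have hsr : ∀ r ∈ Set.Icc (0 : ℝ) 1, |s * r| ≤ |s| := fun r hr => by
    rw [abs_mul]
    exact mul_le_of_le_one_right (abs_nonneg _) (abs_le.2 ⟨by linarith [hr.1], hr.2⟩)
  have hf₁B : ∀ᵐ ω ∂μ, |f₁ ω| ≤ B' * 2 := by
    filter_upwards [hD, hrange] with ω h1 h2
    simp only [f₁]
    rw [abs_mul]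
    exact mul_le_mul h1 (hexp _ (hsr _ (h2 j).2)) (abs_nonneg _) ((abs_nonneg _).trans h1)
  have hf₂B : ∀ᵐ ω ∂μ, |f₂ ω| ≤ B' * 2 := by
    filter_upwards [hD, hrange] with ω h1 h2
    simp only [f₂]
    rw [abs_mul]
    exact mul_le_mul h1 (hexp _ (by rw [abs_neg]; exact hsr _ (h2 0).2)) (abs_nonneg _)
      ((abs_nonneg _).trans h1)
  have hDint : Integrable D μ := integrable_of_ae_abs_le (hD𝒢.mono h𝒢le le_rfl) hD
  have hf₁int : Integrable f₁ μ := integrable_of_ae_abs_le (hf₁𝒢.mono h𝒢le le_rfl) hf₁B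
  have hf₂int : Integrable f₂ μ := integrable_of_ae_abs_le (hf₂𝒢.mono h𝒢le le_rfl) hf₂B
  have hindint : ∀ i, Integrable (ind i) μ := fun i =>
    integrable_of_ae_abs_le (hind i) (ae_of_all _ (hind1 i))
  have hmulind : ∀ f : Ω → ℝ, Integrable f μ → ∀ i, Integrable (f * ind i) μ := fun f hf i =>
    hf.mul_bdd (c := 1) (hind i).aestronglyMeasurable (ae_of_all _ (hind1 i))
  -- The pull probability is known to be `1 / n` only where `V` is nonzero, that is, where both
  -- items are active; vanishing of `f` elsewhere covers the rest.
  have hcond : ∀ f : Ω → ℝ, Measurable[𝒢] f → Integrable f μ → (∀ ω, V ω = 0 → f ω = 0) →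
      ∀ i, i = j ∨ i = 0 → ∫ ω, f ω * ind i ω ∂μ = ∫ ω, f ω * (1 / n) ∂μ := by
    intro f hf hfint hfV i hi
    rw [integral_mul_eq_integral_mul_condExp h𝒢le hf.stronglyMeasurable (hmulind f hfint i)
      (hindint i)]
    refine integral_congr_ae ?_
    filter_upwards [hsamp i hi] with ω hω
    by_cases h : V ω = 0
    · rw [hfV ω h]; simp
    · rw [← hω h]
  have hexpand : ∀ ω, V ω * Real.exp (increment w n s j (W ω) (c ω) (I ω)) =
      D ω + f₁ ω * ind j ω + f₂ ω * ind 0 ω := fun ω => by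
    rw [exp_increment w n s hj]
    simp only [D, f₁, f₂, ind, Set.indicator_apply, Set.mem_ofPred_eq]
    ring
  have hDV : ∀ ω, V ω = 0 → D ω = 0 := fun ω h => by simp only [D]; rw [h, zero_mul]
  have hi₁ : Integrable (fun ω => f₁ ω * ind j ω) μ := hmulind f₁ hf₁int j
  have hi₂ : Integrable (fun ω => f₂ ω * ind 0 ω) μ := hmulind f₂ hf₂int 0
  have hWint : Integrable (fun ω => Real.exp (s / n * (W ω j - W ω 0))) μ := by
    have := hν.isProbabilityMeasure
    have h0 : Integrable (fun x : Fin L → ℝ => Real.exp (s / n * (x j - x 0))) ν := by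
      refine integrable_of_ae_abs_le (by fun_prop) (B := Real.exp |s / n|) ?_
      filter_upwards [hν.support] with x hx
      rw [Real.abs_exp]
      refine Real.exp_le_exp.2 ((le_abs_self _).trans ?_)
      rw [abs_mul]
      refine mul_le_of_le_one_right (abs_nonneg _) (abs_le.2 ⟨?_, ?_⟩)
      · linarith [(hx j).1, (hx 0).2]
      · linarith [(hx j).2, (hx 0).1]
    rw [← hlaw] at h0
    exact h0.comp_measurable hW
  -- Independence is needed only for the true rewards: the corruptions, which may depend on both the
  -- past and `W`, cancel in `exp_conditional_le`.
  have hindepf : IndepFun V (fun ω => Real.exp (s / n * (W ω j - W ω 0))) μ := by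
    have hm : Measurable fun x : Fin L → ℝ => Real.exp (s / n * (x j - x 0)) := by fun_prop
    refine indep_of_indep_of_le_left (indep_of_indep_of_le_right hindep.symm ?_) hV.comap_le
    exact (hm.comp (comap_measurable W)).comap_le
  have hprod : Integrable (fun ω => V ω * Real.exp (s / n * (W ω j - W ω 0))) μ :=
    hindepf.integrable_mul hVint hWint
  refine ⟨?_, ?_⟩
  · simp_rw [hexpand]
    exact (hDint.add hi₁).add hi₂
  simp_rw [hexpand]
  have e1 : ∫ ω, (D ω + f₁ ω * ind j ω + f₂ ω * ind 0 ω) ∂μ =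
      ∫ ω, (D ω + f₁ ω * (1 / n) + f₂ ω * (1 / n)) ∂μ := by
    have hadd : ∀ g₁ g₂ : Ω → ℝ, Integrable g₁ μ → Integrable g₂ μ →
        ∫ ω, (D ω + g₁ ω + g₂ ω) ∂μ = ∫ ω, D ω ∂μ + ∫ ω, g₁ ω ∂μ + ∫ ω, g₂ ω ∂μ :=
      fun g₁ g₂ h₁ h₂ => by
        rw [← integral_add hDint h₁]
        exact integral_add (hDint.add h₁) h₂
    rw [hadd _ _ hi₁ hi₂, hadd _ _ (hf₁int.mul_const _) (hf₂int.mul_const _),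
      hcond f₁ hf₁𝒢 hf₁int (fun ω h => by simp only [f₁]; rw [hDV ω h, zero_mul]) j (Or.inl rfl),
      hcond f₂ hf₂𝒢 hf₂int (fun ω h => by simp only [f₂]; rw [hDV ω h, zero_mul]) 0 (Or.inr rfl)]
  rw [e1]
  have e2 : ∫ ω, (D ω + f₁ ω * (1 / n) + f₂ ω * (1 / n)) ∂μ ≤
      ∫ ω, V ω * Real.exp (s / n * (W ω j - W ω 0)) * Real.exp ((s * gap w j - s ^ 2) / n) ∂μ := by
    refine integral_mono_ae ((hDint.add (hf₁int.mul_const _)).add (hf₂int.mul_const _))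
      (hprod.mul_const _) ?_
    filter_upwards [hrange] with ω hω
    have h := mul_le_mul_of_nonneg_left (exp_conditional_le (Δ := gap w j) hn hs (hω j).2 (hω 0).2
      rfl rfl) (hV0 ω)
    refine le_trans (le_of_eq ?_) (h.trans (le_of_eq ?_))
    · simp only [D, f₁, f₂]; ring
    · ring
  refine e2.trans ?_
  have hval : ∫ ω, Real.exp (s / n * (W ω j - W ω 0)) ∂μ ≤
      Real.exp (-(s / n * gap w j) + (s / n) ^ 2) := by
    have h := integral_exp_sub_le hν j (s := s / n) (by
      rw [abs_div, abs_of_pos hn0]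
      exact (div_le_self (abs_nonneg _) hn).trans hs)
    rw [← hlaw, integral_map hW.aemeasurable
      (Measurable.aestronglyMeasurable (by fun_prop))] at h
    exact h
  have hfact : ∫ ω, V ω * Real.exp (s / n * (W ω j - W ω 0)) ∂μ =
      (∫ ω, V ω ∂μ) * ∫ ω, Real.exp (s / n * (W ω j - W ω 0)) ∂μ :=
    hindepf.integral_mul_eq_mul_integral hVint.aestronglyMeasurable hWint.aestronglyMeasurable
  rw [integral_mul_const, hfact, mul_assoc]
  refine mul_le_of_le_one_right (integral_nonneg hV0) ?_
  refine (mul_le_mul_of_nonneg_right hval (Real.exp_nonneg _)).trans ?_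
  rw [← Real.exp_add, Real.exp_le_one_iff]
  -- The reward noise enters at scale `s / n`, so its variance term fits into the last `s ^ 2 / n`.
  have h1 : (s / n) ^ 2 ≤ s ^ 2 / n := by
    rw [div_pow]
    refine div_le_div_of_nonneg_left (sq_nonneg s) hn0 ?_
    nlinarith
  have h2 : -(s / n * gap w j) + s ^ 2 / n + (s * gap w j - s ^ 2) / n = 0 := by ring
  linarith

/-! ### Gaps, sizes of active sets, and the exponential process. -/

theorem IsInstance.mean_mem_Icc {L : ℕ} [NeZero L] {w : Fin L → ℝ} {ν : Measure (Fin L → ℝ)}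
    (hν : IsInstance w ν) (i : Fin L) : w i ∈ Set.Icc (0 : ℝ) 1 := by
  have := hν.isProbabilityMeasure
  rw [← hν.mean i]
  constructor
  · refine integral_nonneg_of_ae ?_
    filter_upwards [hν.support] with x hx using (hx i).1
  · have h : Integrable (fun x : Fin L → ℝ => x i) ν :=
      integrable_of_ae_abs_le (measurable_pi_apply i) (B := 1) (by
        filter_upwards [hν.support] with x hx
        exact abs_le.2 ⟨by linarith [(hx i).1], (hx i).2⟩)
    calc ∫ x, x i ∂ν ≤ ∫ _, (1 : ℝ) ∂ν := integral_mono_ae h (integrable_const _) (by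
          filter_upwards [hν.support] with x hx using (hx i).2)
      _ = 1 := by simp

theorem IsInstance.gap_le_one {L : ℕ} [NeZero L] {w : Fin L → ℝ} {ν : Measure (Fin L → ℝ)}
    (hν : IsInstance w ν) (i : Fin L) : gap w i ≤ 1 := by
  have h1 := (hν.mean_mem_Icc 0).2
  have h2 := (hν.mean_mem_Icc i).1
  unfold gap
  linarith

theorem IsInstance.gap_pos {L : ℕ} [NeZero L] {w : Fin L → ℝ} {ν : Measure (Fin L → ℝ)}
    (hν : IsInstance w ν) {i : Fin L} (hi : i ≠ 0) : 0 < gap w i :=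
  sub_pos.2 (hν.best i hi)

theorem IsInstance.gap_mono {L : ℕ} [NeZero L] {w : Fin L → ℝ} {ν : Measure (Fin L → ℝ)}
    (hν : IsInstance w ν) {i j : Fin L} (hij : i ≤ j) : gap w i ≤ gap w j :=
  sub_le_sub_left (hν.antitone hij) _

theorem IsPSS.card_active {L : ℕ} {Ω : Type*} [MeasurableSpace Ω] {μ : Measure Ω}
    {ℱ : Filtration ℕ _} {u : ℝ} {T : ℕ} {W c : ℕ → Ω → Fin L → ℝ} {I : ℕ → Ω → Fin L}
    {A : ℕ → Ω → Finset (Fin L)} {out : Ω → Fin L} (hA : IsPSS μ ℱ u T W c I A out) {m : ℕ} (hm : m ≤ numPhases L u)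
    (ω : Ω) : (A m ω).card = ⌈(L : ℝ) / u ^ m⌉₊ := by
  cases m with
  | zero => simp [hA.active_zero ω]
  | succ m => exact hA.active_card m hm ω

/-- The exponential supermartingale comparing items `j` and `0` during phase `m + 1`. -/
noncomputable def expProcess {L : ℕ} [NeZero L] {Ω : Type*} (w : Fin L → ℝ) (W c : ℕ → Ω → Fin L → ℝ) (I : ℕ → Ω → Fin L)
    (n s : ℝ) (j : Fin L) (E : Set Ω) (t₀ k : ℕ) (ω : Ω) : ℝ :=
  E.indicator (fun _ => (1 : ℝ)) ω *
    Real.exp (∑ t ∈ Finset.Ioc t₀ (t₀ + k), increment w n s j (W t ω) (c t ω) (I t ω))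

theorem expProcess_succ {L : ℕ} [NeZero L] {Ω : Type*} {w : Fin L → ℝ}
    {W c : ℕ → Ω → Fin L → ℝ} {I : ℕ → Ω → Fin L} (n s : ℝ) (j : Fin L) (E : Set Ω) (t₀ k : ℕ) (ω : Ω) :
    expProcess w W c I n s j E t₀ (k + 1) ω = expProcess w W c I n s j E t₀ k ω *
      Real.exp (increment w n s j (W (t₀ + k + 1) ω) (c (t₀ + k + 1) ω) (I (t₀ + k + 1) ω)) := by
  unfold expProcess
  rw [← add_assoc, ← Finset.insert_Ioc_right_eq_Ioc_add_one (by omega),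
    Finset.sum_insert (by simp), add_comm (increment _ _ _ _ _ _ _), Real.exp_add, mul_assoc]

theorem expProcess_nonneg {L : ℕ} [NeZero L] {Ω : Type*} {w : Fin L → ℝ}
    {W c : ℕ → Ω → Fin L → ℝ} {I : ℕ → Ω → Fin L} (n s : ℝ) (j : Fin L) (E : Set Ω) (t₀ k : ℕ) (ω : Ω) :
    0 ≤ expProcess w W c I n s j E t₀ k ω :=
  mul_nonneg (Set.indicator_nonneg (fun _ _ => zero_le_one) _) (Real.exp_nonneg _)

/-! ### Deviation bound for a single phase. -/

section Run

variable {L : ℕ} [NeZero L] {Ω : Type*} [mΩ : MeasurableSpace Ω] {μ : Measure Ω}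
  [IsProbabilityMeasure μ] {ℱ : Filtration ℕ mΩ} {w : Fin L → ℝ} {ν : Measure (Fin L → ℝ)} {T : ℕ}
  {C : ℝ} {W c : ℕ → Ω → Fin L → ℝ} {I : ℕ → Ω → Fin L} {u : ℝ} {A : ℕ → Ω → Finset (Fin L)}
  {out : Ω → Fin L}

/-- The three claims go through one induction on the number of steps: measurability and boundedness
up to step `k` are what the one-step supermartingale inequality needs at step `k + 1`. -/
theorem expProcess_bound (hrun : IsCorruptedRun μ ℱ ν T C W c I) (hν : IsInstance w ν)
    (hA : IsPSS μ ℱ u T W c I A out) {m : ℕ} (hm : m < numPhases L u) {n s : ℝ}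
    (hn : 1 ≤ n) (hcard : ∀ ω, ((A m ω).card : ℝ) = n) (hs : |s| ≤ 1) {j : Fin L} (hj : j ≠ 0)
    {k : ℕ} (hk : k ≤ phaseLength L u T) :
    Measurable[ℱ (m * phaseLength L u T + k)]
      (expProcess w W c I n s j {ω | 0 ∈ A m ω ∧ j ∈ A m ω} (m * phaseLength L u T) k) ∧
    (∀ᵐ ω ∂μ, expProcess w W c I n s j {ω | 0 ∈ A m ω ∧ j ∈ A m ω} (m * phaseLength L u T) k ω
      ≤ Real.exp (k * (6 + |gap w j|))) ∧
    ∫ ω, expProcess w W c I n s j {ω | 0 ∈ A m ω ∧ j ∈ A m ω} (m * phaseLength L u T) k ω ∂μ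
      ≤ 1 := by
  set N := phaseLength L u T with hN
  set E : Set Ω := {ω | 0 ∈ A m ω ∧ j ∈ A m ω} with hE
  have hEm : MeasurableSet[ℱ (m * N)] E :=
    (hA.measurable_active m hm.le 0).inter (hA.measurable_active m hm.le j)
  have hT : (m + 1) * N ≤ T :=
    (Nat.mul_le_mul_right N hm).trans (Nat.mul_div_le T (numPhases L u))
  have hT' : m * N + N ≤ T := by rwa [add_mul, one_mul] at hT
  induction k with
  | zero =>
    have h0 : expProcess w W c I n s j E (m * N) 0 = E.indicator (fun _ => (1 : ℝ)) := by
      funext ω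
      simp [expProcess]
    have hle : ∀ ω, E.indicator (fun _ => (1 : ℝ)) ω ≤ 1 := fun ω =>
      Set.indicator_le_self' (fun _ _ => zero_le_one) ω
    rw [h0]
    refine ⟨measurable_const.indicator hEm, ae_of_all _ fun ω => ?_, ?_⟩
    · simpa using hle ω
    · have hE' : MeasurableSet E := ℱ.le _ _ hEm
      rw [integral_indicator_const _ hE']
      simp [measureReal_le_one]
  | succ k ih =>
    obtain ⟨h1, h2, h3⟩ := ih (by omega)
    have ht1 : 1 ≤ m * N + k + 1 := by omega
    have htT : m * N + k + 1 ≤ T := by omega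
    have hWm := hrun.measurable_reward _ ht1 htT
    have hcm := hrun.measurable_corruption _ ht1 htT
    have hIm := hrun.measurable_pull _ ht1 htT
    have hle := ℱ.le (m * N + k + 1)
    have hstep : (fun ω => expProcess w W c I n s j E (m * N) (k + 1) ω) = fun ω =>
      expProcess w W c I n s j E (m * N) k ω * Real.exp (increment w n s j
        (W (m * N + k + 1) ω) (c (m * N + k + 1) ω) (I (m * N + k + 1) ω)) :=
      funext fun ω => expProcess_succ n s j E (m * N) k ω
    have hrange : ∀ᵐ ω ∂μ, ∀ i, c (m * N + k + 1) ω i ∈ Set.Icc (-1 : ℝ) 1 ∧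
        W (m * N + k + 1) ω i + c (m * N + k + 1) ω i ∈ Set.Icc (0 : ℝ) 1 := by
      filter_upwards [hrun.corruption_range] with ω hω using hω _ ht1 htT
    refine ⟨?_, ?_, ?_⟩
    · change Measurable[ℱ (m * N + k + 1)]
        (fun ω => expProcess w W c I n s j E (m * N) (k + 1) ω)
      rw [hstep]
      exact (h1.mono (ℱ.mono (Nat.le_succ _)) le_rfl).mul
        (measurable_increment w n s j hWm hcm hIm).exp
    · filter_upwards [h2, hrange] with ω hω hω'
      rw [expProcess_succ]
      push_cast
      rw [add_mul, one_mul, Real.exp_add]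
      exact mul_le_mul hω (Real.exp_le_exp.2 ((le_abs_self _).trans
        (abs_increment_le w hn hs j _ hω'))) (Real.exp_nonneg _) (Real.exp_nonneg _)
    · rw [hstep]
      refine le_trans (integral_mul_exp_increment_le hν (ℱ.le (m * N + k))
        (hWm.mono hle le_rfl) (hcm.mono hle le_rfl) (hIm.mono hle le_rfl)
        (hrun.reward_law _ ht1 htT) (hrun.reward_fresh _ (by omega)) hrange h1
        (expProcess_nonneg n s j E (m * N) k) h2 hn hs hj rfl ?_).2 h3
      intro i hi
      filter_upwards [hA.sampling m hm (m * N + k)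
        (Nat.le_add_right _ _) (by rw [← hN, add_mul, one_mul]; omega) i] with ω hω hV
      have hωE : ω ∈ E := by
        by_contra h
        exact hV (by simp [expProcess, h])
      rw [hω, if_pos (by rcases hi with rfl | rfl; exacts [hωE.2, hωE.1]), hcard]

/-- The probability that, in phase `m + 1`, an item with a large gap beats item `0`. -/
theorem measureReal_empMean_le (hrun : IsCorruptedRun μ ℱ ν T C W c I) (hν : IsInstance w ν)
    (hA : IsPSS μ ℱ u T W c I A out) (hu : 0 < u) {m : ℕ} (hm : m < numPhases L u)
    (hN : 0 < phaseLength L u T) {j : Fin L} (hj : j ≠ 0)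
    (hC : 4 * C / phaseLength L u T < gap w j) :
    μ.real {ω | (0 ∈ A m ω ∧ j ∈ A m ω) ∧ empMean (phaseLength L u T) W c I m (A m ω) ω 0 ≤
        empMean (phaseLength L u T) W c I m (A m ω) ω j} ≤
      Real.exp (-(phaseLength L u T * gap w j ^ 2 / (48 * ⌈(L : ℝ) / u ^ m⌉₊))) := by
  set N := phaseLength L u T with hNdef
  set n : ℝ := (⌈(L : ℝ) / u ^ m⌉₊ : ℝ) with hn
  have hL : (0 : ℝ) < L := Nat.cast_pos.2 (NeZero.pos L)
  have hn1 : 1 ≤ n := by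
    rw [hn, Nat.one_le_cast, Nat.one_le_ceil_iff]
    positivity
  have hn0 : 0 < n := by linarith
  have hNr : (0 : ℝ) < N := Nat.cast_pos.2 hN
  have hcard : ∀ ω, ((A m ω).card : ℝ) = n := fun ω => by rw [hA.card_active hm.le, hn]
  have hg0 := hν.gap_pos hj
  have hg1 := hν.gap_le_one j
  -- This maximizes `s * Δ / 2 - 3 * s ^ 2`, the drift left after corruption takes half of `s * Δ`;
  -- the maximum is `Δ ^ 2 / 48`.
  set s := gap w j / 12 with hs
  have hs0 : 0 < s := by positivity
  have hs1 : |s| ≤ 1 := by rw [abs_of_pos hs0]; linarith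
  have hT : (m + 1) * N ≤ T :=
    (Nat.mul_le_mul_right N hm).trans (Nat.mul_div_le T (numPhases L u))
  obtain ⟨h1, h2, h3⟩ := expProcess_bound hrun hν hA hm hn1 hcard hs1 hj (le_refl N)
  set V := expProcess w W c I n s j {ω | 0 ∈ A m ω ∧ j ∈ A m ω} (m * N) N with hV
  have hV0 : ∀ ω, 0 ≤ V ω := expProcess_nonneg _ _ _ _ _ _
  have hVint : Integrable V μ :=
    integrable_of_ae_abs_le (h1.mono (ℱ.le _) le_rfl) (by
      filter_upwards [h2] with ω hω
      rwa [abs_of_nonneg (hV0 ω)])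
  set κ := N * gap w j ^ 2 / (48 * n) with hκ
  have hsub : ∀ᵐ ω ∂μ, ω ∈ {ω | (0 ∈ A m ω ∧ j ∈ A m ω) ∧
      empMean N W c I m (A m ω) ω 0 ≤ empMean N W c I m (A m ω) ω j} →
      ω ∈ {ω | Real.exp κ ≤ V ω} := by
    filter_upwards [hrun.budget] with ω hb ⟨hω, hle⟩
    change Real.exp κ ≤ V ω
    rw [hV, expProcess, Set.indicator_of_mem (by exact hω), one_mul]
    refine Real.exp_le_exp.2 ?_
    have hIoc : Finset.Ioc (m * N) (m * N + N) = Finset.Ioc (m * N) ((m + 1) * N) := by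
      rw [add_mul, one_mul]
    rw [hIoc]
    have hemp : (∑ t ∈ Finset.Ioc (m * N) ((m + 1) * N),
          if I t ω = 0 then W t ω (I t ω) + c t ω (I t ω) else 0) ≤
        ∑ t ∈ Finset.Ioc (m * N) ((m + 1) * N),
          if I t ω = j then W t ω (I t ω) + c t ω (I t ω) else 0 := by
      unfold empMean at hle
      rw [hcard ω] at hle
      exact (div_le_div_iff_of_pos_right (by positivity)).1 hle
    -- The adversary may spend the whole budget in this phase, raising `j` and lowering `0` at once:
    -- hence the factor 2.
    have hcorr : ∑ t ∈ Finset.Ioc (m * N) ((m + 1) * N), (c t ω j - c t ω 0) ≤ 2 * C := by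
      calc _ ≤ ∑ t ∈ Finset.Ioc (m * N) ((m + 1) * N), 2 * ⨆ i, |c t ω i| := by
            refine Finset.sum_le_sum fun t _ => ?_
            have hbdd : BddAbove (Set.range fun i => |c t ω i|) := Set.finite_range _ |>.bddAbove
            have e1 := (le_abs_self _).trans (le_ciSup hbdd j)
            have e2 := (neg_le_abs _).trans (le_ciSup hbdd 0)
            linarith
        _ ≤ ∑ t ∈ Finset.Icc 1 T, 2 * ⨆ i, |c t ω i| := by
            refine Finset.sum_le_sum_of_subset_of_nonneg (fun t ht => ?_) fun t _ _ =>
              mul_nonneg zero_le_two (Real.iSup_nonneg fun i => abs_nonneg _)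
            rw [Finset.mem_Ioc] at ht
            rw [Finset.mem_Icc]
            omega
        _ ≤ 2 * C := by rw [← Finset.mul_sum]; linarith
    have hsum : ∑ t ∈ Finset.Ioc (m * N) ((m + 1) * N),
          increment w n s j (W t ω) (c t ω) (I t ω) =
        s * ((∑ t ∈ Finset.Ioc (m * N) ((m + 1) * N),
            if I t ω = j then W t ω (I t ω) + c t ω (I t ω) else 0) -
          ∑ t ∈ Finset.Ioc (m * N) ((m + 1) * N),
            if I t ω = 0 then W t ω (I t ω) + c t ω (I t ω) else 0) -
        s / n * (∑ t ∈ Finset.Ioc (m * N) ((m + 1) * N), (c t ω j - c t ω 0)) +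
        N * ((s * gap w j - 3 * s ^ 2) / n) := by
      unfold increment
      rw [Finset.sum_add_distrib, Finset.sum_sub_distrib, ← Finset.mul_sum,
        Finset.sum_sub_distrib (f := fun t => if I t ω = j then _ else _), Finset.sum_const,
        Nat.card_Ioc, nsmul_eq_mul, Finset.mul_sum (a := s / n)]
      congr 2
      · exact Finset.sum_congr rfl fun t _ => by ring
      · rw [add_mul, one_mul, Nat.add_sub_cancel_left]
    have hC' : 2 * C ≤ N * gap w j / 2 := by
      rw [div_lt_iff₀ hNr] at hC
      linarith
    rw [hsum]
    have e1 := mul_nonneg hs0.le (sub_nonneg.2 hemp)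
    have e2 := mul_le_mul_of_nonneg_left (hcorr.trans hC') (div_pos hs0 hn0).le
    have e3 : κ = N * ((s * gap w j - 3 * s ^ 2) / n) - s / n * (N * gap w j / 2) := by
      rw [hκ, hs]
      field_simp
      ring
    linarith
  have hmarkov := mul_meas_ge_le_integral_of_nonneg (ae_of_all _ hV0) hVint (Real.exp κ)
  have hmono : μ.real {ω | (0 ∈ A m ω ∧ j ∈ A m ω) ∧
      empMean N W c I m (A m ω) ω 0 ≤ empMean N W c I m (A m ω) ω j} ≤
      μ.real {ω | Real.exp κ ≤ V ω} :=
    ENNReal.toReal_mono (measure_ne_top _ _) (measure_mono_ae hsub)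
  refine hmono.trans ?_
  rw [Real.exp_neg, ← one_div, le_div_iff₀' (Real.exp_pos _)]
  exact hmarkov.trans h3

end Run

/-! ### Roundings and the hardness. -/

theorem two_le_of_parameter {L : ℕ} {u : ℝ} (hu : 1 < u) (huL : u ≤ L) : 2 ≤ L := by
  have : (1 : ℝ) < L := hu.trans_le huL
  exact_mod_cast this

theorem one_le_logb {L : ℕ} {u : ℝ} (hu : 1 < u) (huL : u ≤ L) : 1 ≤ Real.logb u L := by
  rw [Real.le_logb_iff_rpow_le hu (by linarith), Real.rpow_one]
  exact huL

theorem one_le_numPhases {L : ℕ} {u : ℝ} (hu : 1 < u) (huL : u ≤ L) : 1 ≤ numPhases L u := by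
  rw [numPhases, Nat.one_le_ceil_iff]
  linarith [one_le_logb hu huL]

theorem numPhases_le {L : ℕ} {u : ℝ} (hu : 1 < u) (huL : u ≤ L) :
    (⌈Real.logb u L⌉₊ : ℝ) ≤ 2 * Real.logb u L := by
  have h := one_le_logb hu huL
  have := Nat.ceil_lt_add_one (a := Real.logb u L) (by linarith)
  linarith

theorem ceil_div_pow_numPhases {L : ℕ} [NeZero L] {u : ℝ} (hu : 1 < u) :
    ⌈(L : ℝ) / u ^ numPhases L u⌉₊ ≤ 1 := by
  have hL : (0 : ℝ) < L := Nat.cast_pos.2 (NeZero.pos L)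
  rw [Nat.ceil_le, Nat.cast_one, div_le_one (by positivity), ← Real.rpow_natCast,
    ← Real.logb_le_iff_le_rpow hu hL]
  exact Nat.le_ceil _

theorem le_hardness {L : ℕ} [NeZero L] (w : Fin L → ℝ) (u : ℝ) {j : Fin L} (hj : j ≠ 0) :
    min (u * ((j.val : ℝ) + 1)) (L : ℝ) / gap w j ^ 2 ≤ hardness w u :=
  le_ciSup (f := fun i : {i : Fin L // i ≠ 0} =>
    min (u * ((i.1.val : ℝ) + 1)) (L : ℝ) / gap w i.1 ^ 2) (Set.finite_range _).bddAbove ⟨j, hj⟩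

/-- Gaps are at most 1 and the numerators at least 1. This keeps the exponential rate below 1, so
that dropping the floor in the exponent costs at most a factor `e`. -/
theorem one_le_hardness {L : ℕ} [NeZero L] {w : Fin L → ℝ} {ν : Measure (Fin L → ℝ)}
    (hν : IsInstance w ν) {u : ℝ} (hu : 1 < u) (huL : u ≤ L) : 1 ≤ hardness w u := by
  have hL := two_le_of_parameter hu huL
  obtain ⟨j, hj⟩ : ∃ j : Fin L, j ≠ 0 :=
    ⟨⟨1, hL⟩, fun h => by simpa using congrArg Fin.val h⟩
  refine le_trans ?_ (le_hardness w u hj)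
  have hg := hν.gap_pos hj
  rw [one_le_div (by positivity)]
  refine (pow_le_one₀ hg.le (hν.gap_le_one j)).trans (le_min ?_ (by linarith))
  have : (0 : ℝ) ≤ j.val := Nat.cast_nonneg _
  nlinarith

/-- One phase shrinks the active set by a factor of about `u`, so an item ranked beyond the next
size has rank comparable to the current size divided by `u`. -/
theorem ceil_div_pow_le_hardness {L : ℕ} [NeZero L] {w : Fin L → ℝ} {ν : Measure (Fin L → ℝ)}
    (hν : IsInstance w ν) {u : ℝ} (hu : 1 < u) {m : ℕ} {j : Fin L} (hj : j ≠ 0)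
    (hmj : ⌈(L : ℝ) / u ^ (m + 1)⌉₊ ≤ j.val) :
    (⌈(L : ℝ) / u ^ m⌉₊ : ℝ) ≤ hardness w u * gap w j ^ 2 := by
  have hg := hν.gap_pos hj
  rw [← div_le_iff₀ (by positivity)]
  refine le_trans (div_le_div_of_nonneg_right (le_min ?_ ?_) (by positivity)) (le_hardness w u hj)
  -- The loss of 1 from the ceiling is absorbed because `j` has rank `j.val + 1`, and `u * j.val + 1
  -- ≤ u * (j.val + 1)`.
  · have h1 : (⌈(L : ℝ) / u ^ m⌉₊ : ℝ) ≤ (L : ℝ) / u ^ m + 1 :=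
      (Nat.ceil_lt_add_one (by positivity)).le
    have h2 : (L : ℝ) / u ^ (m + 1) ≤ j.val := Nat.ceil_le.1 hmj
    have h3 : (L : ℝ) / u ^ m = u * (L / u ^ (m + 1)) := by
      rw [pow_succ]
      field_simp
    have h4 := mul_le_mul_of_nonneg_left h2 (show 0 ≤ u by linarith)
    linarith
  · rw [Nat.cast_le, Nat.ceil_le]
    exact div_le_self (Nat.cast_nonneg L) (one_le_pow₀ hu.le)

theorem failureBound_eq {L : ℕ} [NeZero L] (w : Fin L → ℝ) (u : ℝ) (T : ℕ) :
    failureBound w u T = 4 * (numPhases L u * ((L : ℝ) - 1) *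
      Real.exp (-(phaseLength L u T / (192 * hardness w u)))) := by
  unfold failureBound phaseLength numPhases
  rw [Nat.floor_div_eq_div]
  ring_nf

theorem IsCorruptedRun.budget_nonneg {L : ℕ} {Ω : Type*} [mΩ : MeasurableSpace Ω] {μ : Measure Ω}
    [IsProbabilityMeasure μ] {ℱ : Filtration ℕ mΩ} {ν : Measure (Fin L → ℝ)} {T : ℕ} {C : ℝ}
    {W c : ℕ → Ω → Fin L → ℝ} {I : ℕ → Ω → Fin L} (h : IsCorruptedRun μ ℱ ν T C W c I) :
    0 ≤ C := by
  obtain ⟨ω, hω⟩ := h.budget.exists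
  exact (Finset.sum_nonneg fun t _ => Real.iSup_nonneg fun i => abs_nonneg _).trans hω

theorem IsPSS.active_antitone {L : ℕ} {Ω : Type*} [MeasurableSpace Ω] {μ : Measure Ω}
    {ℱ : Filtration ℕ _} {u : ℝ} {T : ℕ} {W c : ℕ → Ω → Fin L → ℝ} {I : ℕ → Ω → Fin L}
    {A : ℕ → Ω → Finset (Fin L)} {out : Ω → Fin L} (hA : IsPSS μ ℱ u T W c I A out) (ω : Ω) {m k : ℕ} (hmk : m ≤ k)
    (hk : k ≤ numPhases L u) : A k ω ⊆ A m ω := by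
  induction k, hmk using Nat.le_induction with
  | base => exact subset_rfl
  | succ k hmk ih => exact (hA.active_subset k hk ω).trans (ih (by omega))

/-! ### Elimination of the best item and the union bound. -/

section PSS

variable {L : ℕ} [NeZero L] {Ω : Type*} [mΩ : MeasurableSpace Ω] {μ : Measure Ω}
  {ℱ : Filtration ℕ mΩ} {w : Fin L → ℝ} {ν : Measure (Fin L → ℝ)} {T : ℕ}
  {C : ℝ} {W c : ℕ → Ω → Fin L → ℝ} {I : ℕ → Ω → Fin L} {u : ℝ} {A : ℕ → Ω → Finset (Fin L)}
  {out : Ω → Fin L}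

/-- If the output is not `ε`-optimal, then item `0` was eliminated in some phase although an item
with a gap above `ε`, and outside the leading ones, survived that phase. -/
theorem IsPSS.exists_beaten (hA : IsPSS μ ℱ u T W c I A out) (hν : IsInstance w ν) (hu : 1 < u)
    {ε : ℝ} (hε : 0 ≤ ε) {ω : Ω} (hω : ε < gap w (out ω)) :
    ∃ m < numPhases L u, ∃ j : Fin L, j ≠ 0 ∧ ⌈(L : ℝ) / u ^ (m + 1)⌉₊ ≤ j.val ∧ ε < gap w j ∧
      (0 ∈ A m ω ∧ j ∈ A m ω) ∧ empMean (phaseLength L u T) W c I m (A m ω) ω 0 ≤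
        empMean (phaseLength L u T) W c I m (A m ω) ω j := by
  have hout0 : out ω ≠ 0 := fun h => by
    rw [h, gap, sub_self] at hω
    linarith
  have hlast : 0 ∉ A (numPhases L u) ω := fun h => by
    have hc := hA.card_active le_rfl ω
    have h1 : (A (numPhases L u) ω).card ≤ 1 := hc.trans_le (ceil_div_pow_numPhases hu)
    exact hout0 (Finset.card_le_one.1 h1 _ (hA.output ω) _ h)
  obtain ⟨m, hm, hm0, hm1⟩ : ∃ m < numPhases L u, 0 ∈ A m ω ∧ 0 ∉ A (m + 1) ω := by
    by_contra! hcon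
    have : ∀ m ≤ numPhases L u, 0 ∈ A m ω := fun m => by
      induction m with
      | zero => intro _; rw [hA.active_zero]; exact Finset.mem_univ _
      | succ m ih => exact fun hm => hcon m hm (ih (by omega))
    exact hlast (this _ le_rfl)
  have hout : out ω ∈ A (m + 1) ω := hA.active_antitone ω hm le_rfl (hA.output ω)
  -- The output itself may have too small an index for the hardness bound. The largest surviving
  -- index keeps a gap above `ε` by monotonicity, and all survivors lie in `Ioc 0 j`, which has
  -- `j.val` elements.
  set j := (A (m + 1) ω).max' ⟨_, hout⟩ with hj
  have hjA : j ∈ A (m + 1) ω := Finset.max'_mem _ _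
  have hj0 : j ≠ 0 := fun h => hm1 (h ▸ hjA)
  refine ⟨m, hm, j, hj0, ?_, hω.trans_le (hν.gap_mono (Finset.le_max' _ _ hout)),
    ⟨hm0, hA.active_subset m hm ω hjA⟩, hA.active_top m hm ω j hjA 0 hm0 hm1⟩
  rw [← hA.active_card m hm ω]
  have hsub : A (m + 1) ω ⊆ Finset.Ioc 0 j := fun i hi => by
    rw [Finset.mem_Ioc]
    exact ⟨Fin.pos_iff_ne_zero.2 fun h : i = 0 => hm1 (h ▸ hi), Finset.le_max' _ _ hi⟩
  simpa using Finset.card_le_card hsub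

theorem measureReal_gap_le_failureBound [IsProbabilityMeasure μ] (hu : 1 < u) (huL : u ≤ L)
    (hν : IsInstance w ν) (hT : 1 ≤ T) (hrun : IsCorruptedRun μ ℱ ν T C W c I)
    (hA : IsPSS μ ℱ u T W c I A out) :
    μ.real {ω | gap w (out ω) > 8 * C * ⌈Real.logb u L⌉₊ / T} ≤ failureBound w u T := by
  have hC := hrun.budget_nonneg
  have hM := one_le_numPhases hu huL
  have hMr : (1 : ℝ) ≤ numPhases L u := by exact_mod_cast hM
  have hL : (2 : ℝ) ≤ L := by exact_mod_cast two_le_of_parameter hu huL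
  have hH := one_le_hardness hν hu huL
  rw [failureBound_eq]
  set M := numPhases L u with hMdef
  set N := phaseLength L u T with hNdef
  have hML : (1 : ℝ) ≤ M * ((L : ℝ) - 1) := by nlinarith
  -- With empty phases the claimed bound is at least 1, hence trivial.
  rcases Nat.eq_zero_or_pos N with hN | hN
  · rw [hN]
    simp only [Nat.cast_zero, zero_div, neg_zero, Real.exp_zero, mul_one]
    exact measureReal_le_one.trans (by linarith)
  have hNr : (0 : ℝ) < N := Nat.cast_pos.2 hN
  have hTr : (0 : ℝ) < T := Nat.cast_pos.2 hT
  -- Flooring loses at most a factor 2 because `N ≥ 1`; this turns the threshold `4 C / N` into `8 C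
  -- M / T`.
  have hTN : T ≤ 2 * (M * N) := by
    have h1 : T < M * (T / M + 1) := Nat.lt_mul_div_succ T hM
    have h2 : T / M = N := rfl
    rw [h2] at h1
    nlinarith
  have hε : 4 * C / N ≤ 8 * C * ⌈Real.logb u L⌉₊ / T := by
    rw [div_le_div_iff₀ hNr hTr]
    have h1 : (T : ℝ) ≤ 2 * (M * N) := by exact_mod_cast hTN
    have h2 := mul_le_mul_of_nonneg_left h1 (show 0 ≤ 4 * C by linarith)
    have h3 : (⌈Real.logb u L⌉₊ : ℝ) = M := rfl
    rw [h3]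
    linarith
  have hε0 : 0 ≤ 4 * C / N := by positivity
  -- The first two conditions do not involve `ω`; including them makes the irrelevant pairs empty,
  -- so the union can run over all `M (L - 1)` pairs.
  set bad : ℕ × Fin L → Set Ω := fun p => {ω | ⌈(L : ℝ) / u ^ (p.1 + 1)⌉₊ ≤ p.2.val ∧
    4 * C / N < gap w p.2 ∧ (0 ∈ A p.1 ω ∧ p.2 ∈ A p.1 ω) ∧
    empMean N W c I p.1 (A p.1 ω) ω 0 ≤ empMean N W c I p.1 (A p.1 ω) ω p.2} with hbad
  set S : Finset (ℕ × Fin L) := Finset.range M ×ˢ Finset.univ.erase 0 with hS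
  have hsub : {ω | gap w (out ω) > 8 * C * ⌈Real.logb u L⌉₊ / T} ⊆ ⋃ p ∈ S, bad p := by
    intro ω hω
    obtain ⟨m, hm, j, hj, h⟩ := hA.exists_beaten hν hu hε0 (hε.trans_lt hω)
    exact Set.mem_biUnion (x := (m, j)) (by simpa [hS, hj] using hm) h
  have hbound : ∀ p ∈ S, μ.real (bad p) ≤ Real.exp (-(N / (192 * hardness w u))) := by
    rintro ⟨m, j⟩ hp
    simp only [hS, Finset.mem_product, Finset.mem_range, Finset.mem_erase, Finset.mem_univ,
      and_true] at hp
    by_cases h : ⌈(L : ℝ) / u ^ (m + 1)⌉₊ ≤ j.val ∧ 4 * C / N < gap w j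
    · have h1 := measureReal_empMean_le hrun hν hA (by linarith) hp.1 hN hp.2 h.2
      refine (measureReal_mono (fun ω hω => hω.2.2)).trans (h1.trans (Real.exp_le_exp.2 ?_))
      have h2 := ceil_div_pow_le_hardness hν hu hp.2 h.1
      have h3 : (0 : ℝ) < ⌈(L : ℝ) / u ^ m⌉₊ := by
        rw [Nat.cast_pos, Nat.ceil_pos]
        positivity
      -- The argument yields 48 in place of 192; the factor 4 in the exponent is slack, as is the
      -- prefactor 4 in the final bound.
      rw [neg_le_neg_iff, div_le_div_iff₀ (by positivity) (by positivity), mul_assoc]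
      refine mul_le_mul_of_nonneg_left ?_ hNr.le
      nlinarith
    · have : bad (m, j) = ∅ := Set.eq_empty_of_forall_notMem fun ω hω => h ⟨hω.1, hω.2.1⟩
      rw [this, measureReal_empty]
      positivity
  have hcardS : (S.card : ℝ) = M * ((L : ℝ) - 1) := by
    rw [hS, Finset.card_product, Finset.card_range, Finset.card_erase_of_mem (Finset.mem_univ _),
      Finset.card_univ, Fintype.card_fin, Nat.cast_mul, Nat.cast_pred (NeZero.pos L)]
  calc _ ≤ μ.real (⋃ p ∈ S, bad p) := measureReal_mono hsub (measure_ne_top _ _)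
    _ ≤ ∑ p ∈ S, μ.real (bad p) := measureReal_biUnion_finset_le _ _
    _ ≤ S.card • Real.exp (-(N / (192 * hardness w u))) := Finset.sum_le_card_nsmul _ _ _ hbound
    _ = M * ((L : ℝ) - 1) * Real.exp (-(N / (192 * hardness w u))) := by
        rw [nsmul_eq_mul, hcardS]
    _ ≤ _ := le_mul_of_one_le_left (by positivity) (by norm_num)

end PSS

/-! ### Upper and lower exponential estimates of the failure bound. -/

section Asymptotics

variable {L : ℕ} [NeZero L] {w : Fin L → ℝ} {ν : Measure (Fin L → ℝ)} {u : ℝ}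

theorem failureBound_le_exp (hν : IsInstance w ν) (hu : 1 < u) (huL : u ≤ L) (T : ℕ) :
    failureBound w u T ≤ 4 * ⌈Real.logb u L⌉₊ * ((L : ℝ) - 1) * (Real.exp 1 *
      Real.exp (-(T / (192 * hardness w u * ⌈Real.logb u L⌉₊)))) := by
  have hL : (2 : ℝ) ≤ L := by exact_mod_cast two_le_of_parameter hu huL
  have hH := one_le_hardness hν hu huL
  have hM : (1 : ℝ) ≤ ⌈Real.logb u L⌉₊ := by exact_mod_cast one_le_numPhases hu huL
  unfold failureBound
  rw [← Real.exp_add]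
  refine mul_le_mul_of_nonneg_left (Real.exp_le_exp.2 ?_)
    (mul_nonneg (by positivity) (by linarith))
  have h1 := (Nat.sub_one_lt_floor ((T : ℝ) / ⌈Real.logb u L⌉₊)).le
  have h2 : 0 < 1 / (192 * hardness w u) := by positivity
  have h3 : 1 / (192 * hardness w u) ≤ 1 := by
    rw [div_le_one (by positivity)]
    linarith
  have h4 : (T : ℝ) / (192 * hardness w u * ⌈Real.logb u L⌉₊) =
      1 / (192 * hardness w u) * (T / ⌈Real.logb u L⌉₊) := by field_simp
  have h5 := mul_le_mul_of_nonneg_left h1 h2.le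
  rw [h4]
  linarith

theorem failureBound_le_const_mul (hν : IsInstance w ν) (hu : 1 < u) (huL : u ≤ L) (T : ℕ) :
    failureBound w u T ≤ 8 * Real.exp 1 * (L * Real.logb u L *
      Real.exp (-(T / (192 * hardness w u * ⌈Real.logb u L⌉₊)))) := by
  have hL : (2 : ℝ) ≤ L := by exact_mod_cast two_le_of_parameter hu huL
  have h1 := numPhases_le hu huL
  have h2 := one_le_logb hu huL
  have h3 : (⌈Real.logb u L⌉₊ : ℝ) * ((L : ℝ) - 1) ≤ 2 * Real.logb u L * L :=
    mul_le_mul h1 (by linarith) (by linarith) (by linarith)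
  refine (failureBound_le_exp hν hu huL T).trans ?_
  calc _ = 4 * (⌈Real.logb u L⌉₊ * ((L : ℝ) - 1)) * (Real.exp 1 *
        Real.exp (-(T / (192 * hardness w u * ⌈Real.logb u L⌉₊)))) := by ring
    _ ≤ 4 * (2 * Real.logb u L * L) * (Real.exp 1 *
        Real.exp (-(T / (192 * hardness w u * ⌈Real.logb u L⌉₊)))) := by gcongr
    _ = _ := by ring

theorem exp_le_failureBound (hν : IsInstance w ν) (hu : 1 < u) (huL : u ≤ L) (T : ℕ) :
    Real.exp (-(1 / (192 * hardness w u) * T)) ≤ failureBound w u T := by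
  have hL : (2 : ℝ) ≤ L := by exact_mod_cast two_le_of_parameter hu huL
  have hH := one_le_hardness hν hu huL
  have hM : (1 : ℝ) ≤ ⌈Real.logb u L⌉₊ := by exact_mod_cast one_le_numPhases hu huL
  have h1 : (⌊(T : ℝ) / ⌈Real.logb u L⌉₊⌋₊ : ℝ) ≤ T :=
    (Nat.floor_le (by positivity)).trans (div_le_self (Nat.cast_nonneg T) hM)
  have h2 : (1 : ℝ) ≤ 4 * ⌈Real.logb u L⌉₊ * ((L : ℝ) - 1) := by nlinarith
  refine le_trans (Real.exp_le_exp.2 ?_) (le_mul_of_one_le_left (Real.exp_nonneg _) h2)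
  rw [neg_le_neg_iff]
  exact mul_le_mul_of_nonneg_left h1 (by positivity)

theorem exists_failureBound_le_exp (hν : IsInstance w ν) (hu : 1 < u) (huL : u ≤ L) :
    ∃ (a : ℝ) (T₀ : ℕ), 0 < a ∧ 1 ≤ T₀ ∧ ∀ T : ℕ, T₀ ≤ T →
      failureBound w u T ≤ Real.exp (-(a * T)) := by
  have hL : (2 : ℝ) ≤ L := by exact_mod_cast two_le_of_parameter hu huL
  have hH := one_le_hardness hν hu huL
  have hM : (1 : ℝ) ≤ ⌈Real.logb u L⌉₊ := by exact_mod_cast one_le_numPhases hu huL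
  set b := 1 / (192 * hardness w u * ⌈Real.logb u L⌉₊) with hb
  have hb0 : 0 < b := by positivity
  set K := 4 * (⌈Real.logb u L⌉₊ : ℝ) * ((L : ℝ) - 1) with hK
  have hK0 : 0 < K := mul_pos (by positivity) (by linarith)
  -- Half of the rate `b` is given up to absorb the prefactor `K * e`, which is at most `exp (b * T
  -- / 2)` from this `T₀` on.
  refine ⟨b / 2, max 1 ⌈(Real.log K + 1) / (b / 2)⌉₊, by positivity, le_max_left _ _, fun T hT => ?_⟩
  have h1 : (Real.log K + 1) / (b / 2) ≤ T := Nat.ceil_le.1 ((le_max_right _ _).trans hT)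
  rw [div_le_iff₀ (by positivity)] at h1
  refine (failureBound_le_exp hν hu huL T).trans ?_
  rw [← hK, ← Real.exp_log hK0, ← Real.exp_add, ← Real.exp_add]
  refine Real.exp_le_exp.2 ?_
  have h2 : (T : ℝ) / (192 * hardness w u * ⌈Real.logb u L⌉₊) = b * T := by rw [hb]; ring
  rw [h2]
  linarith

end Asymptotics

end CorruptedBandit

theorem theorem1 :
    -- the explicit failure bound
    (∀ (L : ℕ) [NeZero L] (u : ℝ), 1 < u → u ≤ L →
      ∀ (w : Fin L → ℝ) (ν : MeasureTheory.Measure (Fin L → ℝ)), CorruptedBandit.IsInstance w ν →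
      ∀ (T : ℕ), 1 ≤ T → ∀ (C : ℝ) (Ω : Type v) [mΩ : MeasurableSpace Ω]
        (μ : MeasureTheory.Measure Ω) [MeasureTheory.IsProbabilityMeasure μ]
        (ℱ : MeasureTheory.Filtration ℕ mΩ)
        (W c : ℕ → Ω → Fin L → ℝ) (I : ℕ → Ω → Fin L)
        (A : ℕ → Ω → Finset (Fin L)) (out : Ω → Fin L),
        CorruptedBandit.IsCorruptedRun μ ℱ ν T C W c I →
        CorruptedBandit.IsPSS μ ℱ u T W c I A out →
        μ.real {ω | CorruptedBandit.gap w (out ω) > 8 * C * ⌈Real.logb u L⌉₊ / T}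
          ≤ CorruptedBandit.failureBound w u T) ∧
    -- its order of magnitude, with a universal constant
    (∃ K : ℝ, 0 < K ∧ ∀ (L : ℕ) [NeZero L] (u : ℝ), 1 < u → u ≤ L →
      ∀ (w : Fin L → ℝ) (ν : MeasureTheory.Measure (Fin L → ℝ)), CorruptedBandit.IsInstance w ν →
      ∀ (T : ℕ), 1 ≤ T →
        CorruptedBandit.failureBound w u T ≤
          K * (L * Real.logb u L *
            Real.exp (-(T / (192 * CorruptedBandit.hardness w u * ⌈Real.logb u L⌉₊))))) ∧
    -- the PAC guarantee; the constants in the exponent depend only on `L`, `u`, `w`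
    (∃ K : ℝ, 0 < K ∧ ∀ (L : ℕ) [NeZero L] (u : ℝ), 1 < u → u ≤ L →
      ∀ (w : Fin L → ℝ), (∃ ν, CorruptedBandit.IsInstance w ν) →
      ∃ (a b : ℝ) (T₀ : ℕ), 0 < a ∧ 0 < b ∧ 1 ≤ T₀ ∧ ∀ T : ℕ, T₀ ≤ T →
        Real.exp (-(b * T)) ≤ CorruptedBandit.failureBound w u T ∧
        CorruptedBandit.failureBound w u T ≤ Real.exp (-(a * T)) ∧
        ∀ (ν : MeasureTheory.Measure (Fin L → ℝ)), CorruptedBandit.IsInstance w ν →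
        ∀ (C : ℝ) (Ω : Type v) [mΩ : MeasurableSpace Ω]
          (μ : MeasureTheory.Measure Ω) [MeasureTheory.IsProbabilityMeasure μ]
          (ℱ : MeasureTheory.Filtration ℕ mΩ)
          (W c : ℕ → Ω → Fin L → ℝ) (I : ℕ → Ω → Fin L)
          (A : ℕ → Ω → Finset (Fin L)) (out : Ω → Fin L),
          CorruptedBandit.IsCorruptedRun μ ℱ ν T C W c I →
          CorruptedBandit.IsPSS μ ℱ u T W c I A out →
          CorruptedBandit.IsPAC μ w out (K * (C * Real.logb u L / T))
            (CorruptedBandit.failureBound w u T)) := by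
  -- Both constants use `⌈log_u L⌉ ≤ 2 log_u L`, valid since `u ≤ L`: `8 e` is `4 * 2 * e`, with `e`
  -- from the floor, and `16` is `8 * 2`.
  refine ⟨?_, ⟨8 * Real.exp 1, by positivity, ?_⟩, ⟨16, by norm_num, ?_⟩⟩
  · intro L _ u hu huL w ν hν T hT C Ω _ μ _ ℱ W c I A out hrun hA
    exact CorruptedBandit.measureReal_gap_le_failureBound hu huL hν hT hrun hA
  · intro L _ u hu huL w ν hν T _
    exact CorruptedBandit.failureBound_le_const_mul hν hu huL T
  -- The law `ν₀` only certifies properties of `w`, such as gaps at most 1; the rates are chosen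
  -- before the actual law `ν` is introduced.
  · rintro L _ u hu huL w ⟨ν₀, hν₀⟩
    obtain ⟨a, T₀, ha, hT₀, hle⟩ := CorruptedBandit.exists_failureBound_le_exp hν₀ hu huL
    have hH := CorruptedBandit.one_le_hardness hν₀ hu huL
    refine ⟨a, 1 / (192 * CorruptedBandit.hardness w u), T₀, ha, by positivity, hT₀,
      fun T hT => ⟨CorruptedBandit.exp_le_failureBound hν₀ hu huL T, hle T hT, ?_⟩⟩
    intro ν hν C Ω _ μ _ ℱ W c I A out hrun hA
    refine (MeasureTheory.measureReal_mono fun ω hω => ?_).trans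
      (CorruptedBandit.measureReal_gap_le_failureBound hu huL hν (hT₀.trans hT) hrun hA)
    rw [Set.mem_ofPred_eq] at hω
    refine lt_of_le_of_lt ?_ hω
    rw [← mul_div_assoc]
    refine div_le_div_of_nonneg_right ?_ (Nat.cast_nonneg T)
    have h := mul_le_mul_of_nonneg_left (CorruptedBandit.numPhases_le hu huL)
      hrun.budget_nonneg
    linarith
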